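/- Let $G=(V,E)$ be any (simple, possibly disconnected) graph. A \emph{ray} is a one-way infinite path in $G$; two rays are \emph{equivalent} if no finite set of vertices separates them, and the equivalence classes of rays are the \emph{ends} of $G$, forming the set $\Omega(G)$. For a finite set $X\subseteq V$ and an end $\omega$, let $C(X,\omega)$ be the unique component of $G-X$ that contains a tail of every ray in $\omega$, and let $\Omega(X,\omega)$ be the set of ends $\eta$ with $C(X,\eta)=C(X,\omega)$. View $G$ as a metric length space: every edge together with its endvertices is a unit interval, and the distance between two points is the length of a shortest arc in $G$ between them ($\infty$ if there is none). Let $|G|=G\cup\Omega(G)$ carry the topology \textsc{MTop}, which has as a basis all open sets of the metric length space $G$ together with the sets $$\hat C_\varepsilon(X,\omega)=C(X,\omega)\cup\Omega(X,\omega)\cup \mathring{E}_\varepsilon(X,C(X,\omega))$$ for $\varepsilon>0$, $X\subseteq V$ finite and $\omega\in\Omega(G)$, where $\mathring{E}_\varepsilon(X,C(X,\omega))$ is the open ball of radius $\varepsilon$ around the subgraph $C(X,\omega)$ in $G$. \textbf{Lemma.} For every graph $G$ and every end $\omega$ of $G$, the following assertions are equivalent: (i) the space $|G|$ with \textsc{MTop}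 is first countable at $\omega$, i.e. $\omega$ has a countable neighbourhood base in $|G|$; (ii) the end $\omega$ is represented by a ray $R$ (that is, $R\in\omega$) such that every component $C$ of $G-R$ has finite neighbourhood $N(C)$, where $N(C)$ is the set of vertices outside $C$ that have a neighbour in $C$. -/

import Mathlib

open Set Topology
open scoped ENNReal

namespace GraphEnds

universe u

variable {V : Type u}

/-! ## Rays and ends -/

/-- A ray (one-way infinite path) of `G`, given by the sequence of its vertices. -/
structure Ray (G : SimpleGraph V) where
  /-- the `n`-th vertex of the ray -/
  vert : ℕ → V
  injective : Function.Injective vert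
  adj : ∀ n, G.Adj (vert n) (vert (n + 1))

variable {G : SimpleGraph V}

namespace Ray

/-- The vertex set of a ray. -/
def verts (R : Ray G) : Set V := Set.range R.vert

/-- The set `X` separates the rays `R` and `S` in `G`: no component of `G - X` meets both. -/
def Separates (X : Set V) (R S : Ray G) : Prop :=
  ¬ ∃ (C : G.ComponentCompl X) (m n : ℕ), R.vert m ∈ C ∧ S.vert n ∈ C

/-- Two rays are equivalent if no finite set of vertices separates them. -/
def Equivalent (R S : Ray G) : Prop :=
  ∀ X : Finset V, ¬ Separates (X : Set V) R S

/-- `C` contains a tail of the ray `R`. -/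
def HasTailIn (R : Ray G) {X : Set V} (C : G.ComponentCompl X) : Prop :=
  ∃ N, ∀ n, N ≤ n → R.vert n ∈ C

theorem exists_notMem_finset (R : Ray G) (X : Finset V) : ∃ N, ∀ n, N ≤ n → R.vert n ∉ X := by
  have hfin : (R.vert ⁻¹' (X : Set V)).Finite :=
    X.finite_toSet.preimage R.injective.injOn
  obtain ⟨N, hN⟩ := hfin.bddAbove
  exact ⟨N + 1, fun n hn hX => by
    have := hN (show n ∈ R.vert ⁻¹' (X : Set V) from hX)
    omega⟩

theorem hasTailIn_of_mem (R : Ray G) {X : Set V} {N : ℕ} (hN : ∀ n, N ≤ n → R.vert n ∉ X)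
    {C : G.ComponentCompl X} {m : ℕ} (hm : N ≤ m) (hC : R.vert m ∈ C) : R.HasTailIn C := by
  refine ⟨m, fun n hn => ?_⟩
  induction n, hn using Nat.le_induction with
  | base => exact hC
  | succ n hmn ih => exact C.mem_of_adj _ _ ih (hN _ (by omega)) (R.adj n)

theorem exists_hasTailIn (R : Ray G) (X : Finset V) :
    ∃ C : G.ComponentCompl (X : Set V), R.HasTailIn C := by
  obtain ⟨N, hN⟩ := R.exists_notMem_finset X
  exact ⟨G.componentComplMk (hN N le_rfl),
    R.hasTailIn_of_mem hN le_rfl (G.componentComplMk_mem (hN N le_rfl))⟩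

theorem eq_of_mem_of_mem {X : Set V} {C D : G.ComponentCompl X} {v : V} (hC : v ∈ C)
    (hD : v ∈ D) : C = D := by
  obtain ⟨_, rfl⟩ := hC
  obtain ⟨_, rfl⟩ := hD
  rfl

theorem HasTailIn.eq {R : Ray G} {X : Set V} {C D : G.ComponentCompl X} (hC : R.HasTailIn C)
    (hD : R.HasTailIn D) : C = D := by
  obtain ⟨M, hM⟩ := hC
  obtain ⟨N, hN⟩ := hD
  exact eq_of_mem_of_mem (hM (max M N) (le_max_left _ _)) (hN (max M N) (le_max_right _ _))

/-- Equivalent rays have tails in the same component of `G - X`, for all finite `X`. -/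
theorem equivalent_iff {R S : Ray G} : R.Equivalent S ↔
    ∀ X : Finset V, ∃ C : G.ComponentCompl (X : Set V), R.HasTailIn C ∧ S.HasTailIn C := by
  classical
  constructor
  · intro h X
    obtain ⟨M, hM⟩ := R.exists_notMem_finset X
    obtain ⟨N, hN⟩ := S.exists_notMem_finset X
    let Y : Finset V :=
      X ∪ ((Finset.range M).image R.vert ∪ (Finset.range N).image S.vert)
    obtain ⟨C, m, n, hm, hn⟩ := not_not.1 (h Y)
    have hXY : (X : Set V) ⊆ (Y : Set V) := by
      intro v hv
      simp only [Y, Finset.coe_union]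
      exact Or.inl hv
    have hmM : M ≤ m := by
      by_contra hlt
      refine SimpleGraph.ComponentCompl.notMem_of_mem hm ?_
      simp only [Y, Finset.coe_union, Finset.coe_image]
      exact Or.inr (Or.inl ⟨m, by simpa using hlt, rfl⟩)
    have hnN : N ≤ n := by
      by_contra hlt
      refine SimpleGraph.ComponentCompl.notMem_of_mem hn ?_
      simp only [Y, Finset.coe_union, Finset.coe_image]
      exact Or.inr (Or.inr ⟨n, by simpa using hlt, rfl⟩)
    exact ⟨C.hom hXY, R.hasTailIn_of_mem hM hmM (C.subset_hom hXY hm),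
      S.hasTailIn_of_mem hN hnN (C.subset_hom hXY hn)⟩
  · intro h X hsep
    obtain ⟨C, ⟨M, hM⟩, N, hN⟩ := h X
    exact hsep ⟨C, M, N, hM M le_rfl, hN N le_rfl⟩

/-- The setoid on rays whose classes are the ends. -/
instance setoid (G : SimpleGraph V) : Setoid (Ray G) where
  r := Equivalent
  iseqv := by
    refine ⟨fun R => ?_, fun {R S} h => ?_, fun {R S T} h₁ h₂ => ?_⟩
    · rw [equivalent_iff]
      intro X
      obtain ⟨C, hC⟩ := R.exists_hasTailIn X
      exact ⟨C, hC, hC⟩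
    · rw [equivalent_iff] at h ⊢
      intro X
      obtain ⟨C, hR, hS⟩ := h X
      exact ⟨C, hS, hR⟩
    · rw [equivalent_iff] at h₁ h₂ ⊢
      intro X
      obtain ⟨C, hR, hS⟩ := h₁ X
      obtain ⟨D, hS', hT⟩ := h₂ X
      obtain rfl := hS.eq hS'
      exact ⟨C, hR, hT⟩

end Ray

/-- The ends of `G`: the equivalence classes of its rays. -/
def End (G : SimpleGraph V) : Type u := Quotient (Ray.setoid G)

/-- The end represented by a ray. -/
def Ray.toEnd (R : Ray G) : End G := Quotient.mk (Ray.setoid G) R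

theorem Ray.toEnd_eq_iff {R S : Ray G} : R.toEnd = S.toEnd ↔ R.Equivalent S :=
  Quotient.eq (r := Ray.setoid G)

namespace End

theorem existsUnique_comp (X : Finset V) (ω : End G) :
    ∃! C : G.ComponentCompl (X : Set V), ∀ R : Ray G, R.toEnd = ω → R.HasTailIn C := by
  obtain ⟨S, rfl⟩ : ∃ S : Ray G, S.toEnd = ω := Quotient.exists_rep ω
  obtain ⟨C, hC⟩ := S.exists_hasTailIn X
  refine ⟨C, fun R hR => ?_, fun D hD => (hD S rfl).eq hC⟩
  obtain ⟨D, hRD, hSD⟩ := Ray.equivalent_iff.1 (Ray.toEnd_eq_iff.1 hR) X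
  rwa [← hSD.eq hC]

/-- `C(X, ω)`: the unique component of `G - X` that contains a tail of every ray in `ω`. -/
noncomputable def comp (X : Finset V) (ω : End G) : G.ComponentCompl (X : Set V) :=
  (existsUnique_comp X ω).choose

theorem hasTailIn_comp (X : Finset V) (R : Ray G) : R.HasTailIn (comp X R.toEnd) :=
  (existsUnique_comp X R.toEnd).choose_spec.1 R rfl

end End

/-- `Ω(X, ω)`: the set of all ends that live in `C(X, ω)`. -/
def liveEnds (X : Finset V) (ω : End G) : Set (End G) := {η | η.comp X = ω.comp X}

/-! ## The graph as a metric length space -/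

/-- The points of `G`, viewed as a 1-complex, in barycentric coordinates: a vertex `v` is the
point with coordinate `1` at `v` and `0` elsewhere; a point of the edge `uv` has coordinates
`1 - t` at `u` and `t` at `v`, with `0 ≤ t ≤ 1`, and `0` elsewhere. -/
@[ext]
structure Point (G : SimpleGraph V) where
  /-- the barycentric coordinates -/
  coord : V → ℝ
  nonneg : ∀ v, 0 ≤ coord v
  supported : (∃ v, coord v = 1 ∧ ∀ w, w ≠ v → coord w = 0) ∨
    ∃ u v, G.Adj u v ∧ coord u + coord v = 1 ∧ ∀ w, w ≠ u → w ≠ v → coord w = 0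

namespace Point

/-- The point lies on the edge `uv` (possibly as an endvertex). -/
def OnEdge (p : Point G) (u v : V) : Prop := G.Adj u v ∧ p.coord u + p.coord v = 1

/-- The length of the straight segment between two points of a common edge, in which every edge
is a unit interval (`⊤` if there is no common edge). -/
noncomputable def segDist (p q : Point G) : ℝ≥0∞ :=
  ⨅ (u : V) (v : V) (_ : p.OnEdge u v ∧ q.OnEdge u v), ENNReal.ofReal |p.coord u - q.coord u|

/-- The least length of a connection from `p` to `q` through vertices: go from `p` to an endvertex
`u` of its edge, follow a path of `G` to an endvertex `v` of the edge of `q`, then go to `q`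
(`u = p` if `p` is a vertex, and `v = q` if `q` is a vertex). -/
noncomputable def viaDist (p q : Point G) : ℝ≥0∞ :=
  ⨅ (u : V) (v : V) (_ : 0 < p.coord u ∧ 0 < q.coord v),
    ENNReal.ofReal (1 - p.coord u) + (G.edist u v : ℝ≥0∞) + ENNReal.ofReal (1 - q.coord v)

/-- The distance of two points of `G`: the length of a shortest arc between them (`⊤` if they lie
in distinct components of `G`). -/
noncomputable def arcDist (p q : Point G) : ℝ≥0∞ := min (segDist p q) (viaDist p q)

theorem coord_le_one (p : Point G) (v : V) : p.coord v ≤ 1 := by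
  rcases p.supported with ⟨u, hu, h0⟩ | ⟨a, b, -, hab, h0⟩
  · by_cases h : v = u
    · subst h; exact hu.le
    · rw [h0 v h]; exact zero_le_one
  · have ha := p.nonneg a
    have hb := p.nonneg b
    by_cases h : v = a
    · subst h; linarith
    · by_cases h' : v = b
      · subst h'; linarith
      · rw [h0 v h h']; exact zero_le_one

theorem exists_pos (p : Point G) : ∃ v, 0 < p.coord v := by
  rcases p.supported with ⟨u, hu, h0⟩ | ⟨a, b, -, hab, h0⟩
  · exact ⟨u, by rw [hu]; exact one_pos⟩
  · by_contra! h
    have := h a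
    have := h b
    linarith

theorem add_eq_one_of_pos (p : Point G) {u v : V} (huv : u ≠ v) (hu : 0 < p.coord u)
    (hv : 0 < p.coord v) : p.OnEdge u v := by
  rcases p.supported with ⟨w, -, h0⟩ | ⟨a, b, hadj, hab, h0⟩
  · have h1 : u = w := by by_contra h; rw [h0 u h] at hu; exact lt_irrefl _ hu
    have h2 : v = w := by by_contra h; rw [h0 v h] at hv; exact lt_irrefl _ hv
    exact absurd (h1.trans h2.symm) huv
  · have h1 : u = a ∨ u = b := by
      by_contra! h; rw [h0 u h.1 h.2] at hu; exact lt_irrefl _ hu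
    have h2 : v = a ∨ v = b := by
      by_contra! h; rw [h0 v h.1 h.2] at hv; exact lt_irrefl _ hv
    rcases h1 with rfl | rfl <;> rcases h2 with rfl | rfl
    · exact absurd rfl huv
    · exact ⟨hadj, hab⟩
    · exact ⟨hadj.symm, by rw [add_comm]; exact hab⟩
    · exact absurd rfl huv

theorem OnEdge.symm {p : Point G} {u v : V} (h : p.OnEdge u v) : p.OnEdge v u :=
  ⟨h.1.symm, by rw [add_comm]; exact h.2⟩

theorem OnEdge.eq_or_eq {p : Point G} {u v w : V} (h : p.OnEdge u v) (hw : 0 < p.coord w) :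
    w = u ∨ w = v := by
  by_contra! hne
  have hu := p.nonneg u
  have hv := p.nonneg v
  have h2 := h.2
  by_cases hu0 : 0 < p.coord u
  · have h1 := (p.add_eq_one_of_pos hne.1 hw hu0).2
    have hv0 : 0 < p.coord v := by
      by_contra hv0
      linarith
    have h3 := (p.add_eq_one_of_pos hne.2 hw hv0).2
    have h4 := (p.add_eq_one_of_pos h.1.ne hu0 hv0).2
    rcases p.supported with ⟨x, hx, h0⟩ | ⟨a, b, hadj, hab, h0⟩
    · by_cases hwx : w = x
      · subst hwx; linarith
      · rw [h0 w hwx] at hw; exact lt_irrefl _ hw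
    · have key : ∀ x, 0 < p.coord x → x = a ∨ x = b := fun x hx => by
        by_contra! hxx; rw [h0 x hxx.1 hxx.2] at hx; exact lt_irrefl _ hx
      have huv := h.1.ne
      rcases key w hw with rfl | rfl <;> rcases key u hu0 with rfl | rfl <;>
        rcases key v hv0 with rfl | rfl <;> simp_all
  · have hv1 : p.coord v = 1 := by linarith
    have h1 := (p.add_eq_one_of_pos hne.2 hw (by linarith)).2
    linarith

theorem edist_le_of_pos (p : Point G) {u v : V} (hu : 0 < p.coord u) (hv : 0 < p.coord v) :
    (G.edist u v : ℝ≥0∞) ≤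
      ENNReal.ofReal (1 - p.coord u) + ENNReal.ofReal (1 - p.coord v) := by
  by_cases huv : u = v
  · subst huv; simp
  · obtain ⟨hadj, h1⟩ := p.add_eq_one_of_pos huv hu hv
    rw [← ENNReal.ofReal_add (by linarith) (by linarith), SimpleGraph.edist_eq_one_iff_adj.2 hadj]
    have : 1 - p.coord u + (1 - p.coord v) = 1 := by linarith
    simp [this]

theorem edist_triangle (u v w : V) :
    (G.edist u w : ℝ≥0∞) ≤ (G.edist u v : ℝ≥0∞) + (G.edist v w : ℝ≥0∞) := by
  have h : G.edist u w ≤ G.edist u v + G.edist v w := SimpleGraph.edist_triangle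
  have h' : ((G.edist u w : ℕ∞) : ℝ≥0∞) ≤ ((G.edist u v + G.edist v w : ℕ∞) : ℝ≥0∞) :=
    ENat.toENNReal_le.2 h
  rwa [ENat.toENNReal_add] at h'

theorem viaDist_le {p q : Point G} {u v : V} (hu : 0 < p.coord u) (hv : 0 < q.coord v) :
    viaDist p q ≤ ENNReal.ofReal (1 - p.coord u) + (G.edist u v : ℝ≥0∞) +
      ENNReal.ofReal (1 - q.coord v) :=
  iInf_le_of_le u <| iInf_le_of_le v <| iInf_le_of_le ⟨hu, hv⟩ le_rfl

theorem segDist_le {p q : Point G} {u v : V} (hp : p.OnEdge u v) (hq : q.OnEdge u v) :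
    segDist p q ≤ ENNReal.ofReal |p.coord u - q.coord u| :=
  iInf_le_of_le u <| iInf_le_of_le v <| iInf_le_of_le ⟨hp, hq⟩ le_rfl

theorem segDist_comm (p q : Point G) : segDist p q = segDist q p := by
  simp only [segDist, abs_sub_comm, and_comm]

theorem viaDist_comm (p q : Point G) : viaDist p q = viaDist q p := by
  unfold viaDist
  rw [iInf_comm]
  refine iInf_congr fun u => iInf_congr fun v => ?_
  rw [and_comm]
  refine iInf_congr fun _ => ?_
  rw [SimpleGraph.edist_comm]
  ring

theorem arcDist_comm (p q : Point G) : arcDist p q = arcDist q p := by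
  rw [arcDist, arcDist, segDist_comm, viaDist_comm]

theorem arcDist_self (p : Point G) : arcDist p p = 0 := by
  refine le_antisymm ?_ zero_le
  rcases p.supported with ⟨v, hv, -⟩ | ⟨u, v, hadj, h1, -⟩
  · have hpos : 0 < p.coord v := by rw [hv]; exact one_pos
    refine (min_le_right _ _).trans ((viaDist_le hpos hpos).trans ?_)
    simp [hv]
  · refine (min_le_left _ _).trans ((segDist_le ⟨hadj, h1⟩ ⟨hadj, h1⟩).trans ?_)
    simp

/-- Auxiliary for the triangle inequality: a vertex `w` of the edge that carries `p`. -/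
theorem viaDist_le_of_onEdge {p r : Point G} {w w' x : V} (hp : p.OnEdge w w')
    (hx : 0 < r.coord x) :
    viaDist p r ≤ ENNReal.ofReal (1 - p.coord w) + (G.edist w x : ℝ≥0∞) +
      ENNReal.ofReal (1 - r.coord x) := by
  by_cases hw : 0 < p.coord w
  · exact viaDist_le hw hx
  · have hw0 : p.coord w = 0 := le_antisymm (not_lt.1 hw) (p.nonneg w)
    have hw1 : p.coord w' = 1 := by have := hp.2; linarith
    refine (viaDist_le (by rw [hw1]; exact one_pos) hx).trans ?_
    refine add_le_add ?_ le_rfl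
    rw [hw0, hw1]
    have := edist_triangle (G := G) w' w x
    rw [SimpleGraph.edist_eq_one_iff_adj.2 hp.1.symm] at this
    simpa using this

theorem viaDist_le_seg_add_via (p q r : Point G) :
    viaDist p r ≤ segDist p q + viaDist q r := by
  rw [segDist, viaDist.eq_1 q r]
  simp only [ENNReal.iInf_add, ENNReal.add_iInf]
  refine le_iInf fun x => le_iInf fun y => le_iInf fun hxy => le_iInf fun a => le_iInf fun b =>
    le_iInf fun hab => ?_
  have main : ∀ z z', p.OnEdge z z' →
      |p.coord z - q.coord z| = |p.coord a - q.coord a| → x = z →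
      viaDist p r ≤ ENNReal.ofReal |p.coord a - q.coord a| +
        (ENNReal.ofReal (1 - q.coord x) + (G.edist x y : ℝ≥0∞) +
          ENNReal.ofReal (1 - r.coord y)) := by
    rintro z z' hz habs rfl
    refine (viaDist_le_of_onEdge hz hxy.2).trans ?_
    rw [← add_assoc, ← add_assoc]
    gcongr
    rw [← habs, ← ENNReal.ofReal_add (abs_nonneg _) (by linarith [q.coord_le_one x])]
    refine ENNReal.ofReal_le_ofReal ?_
    have := neg_abs_le (p.coord x - q.coord x)
    linarith
  rcases hab.2.eq_or_eq hxy.1 with h | h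
  · exact main a b hab.1 rfl h
  · refine main b a hab.1.symm ?_ h
    have h1 := hab.1.2
    have h2 := hab.2.2
    rw [← abs_neg]
    congr 1
    linarith

theorem viaDist_triangle (p q r : Point G) : viaDist p r ≤ viaDist p q + viaDist q r := by
  rw [viaDist, viaDist, viaDist]
  simp only [ENNReal.iInf_add, ENNReal.add_iInf]
  refine le_iInf fun x => le_iInf fun y => le_iInf fun hxy => le_iInf fun a => le_iInf fun b =>
    le_iInf fun hab => ?_
  refine (viaDist_le (p := p) (q := r) (u := a) (v := y) hab.1 hxy.2).trans ?_
  calc ENNReal.ofReal (1 - p.coord a) + (G.edist a y : ℝ≥0∞) + ENNReal.ofReal (1 - r.coord y)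
      ≤ ENNReal.ofReal (1 - p.coord a) + (G.edist a b +
          ((ENNReal.ofReal (1 - q.coord b) + ENNReal.ofReal (1 - q.coord x)) + G.edist x y)) +
            ENNReal.ofReal (1 - r.coord y) := by
        gcongr
        refine (edist_triangle a b y).trans ?_
        gcongr
        refine (edist_triangle b x y).trans ?_
        gcongr
        exact q.edist_le_of_pos hab.2 hxy.1
    _ = _ := by ring

theorem arcDist_le_seg_add_seg (p q r : Point G) :
    arcDist p r ≤ segDist p q + segDist q r := by
  rw [segDist, segDist]
  simp only [ENNReal.iInf_add, ENNReal.add_iInf]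
  refine le_iInf fun c => le_iInf fun d => le_iInf fun hcd => le_iInf fun a => le_iInf fun b =>
    le_iInf fun hab => ?_
  have hp := hab.1
  have hq := hab.2
  have hq' := hcd.1
  have hr := hcd.2
  have tri : ∀ x y z : ℝ, ENNReal.ofReal |x - z| ≤ ENNReal.ofReal |x - y| +
      ENNReal.ofReal |y - z| := fun x y z => by
    rw [← ENNReal.ofReal_add (abs_nonneg _) (abs_nonneg _)]
    exact ENNReal.ofReal_le_ofReal (abs_sub_le x y z)
  have flip : ∀ {s t : Point G} {x y : V}, s.OnEdge x y → t.OnEdge x y →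
      |s.coord x - t.coord x| = |s.coord y - t.coord y| := fun {s t x y} hs ht => by
    have h1 := hs.2
    have h2 := ht.2
    rw [← abs_neg]
    congr 1
    linarith
  -- the case in which `q` is a vertex
  have vertex : ∀ z z₁ z₂ : V, q.coord z = 1 → p.OnEdge z z₁ → r.OnEdge z z₂ →
      |p.coord z - q.coord z| = |p.coord a - q.coord a| →
      |q.coord z - r.coord z| = |q.coord c - r.coord c| →
      arcDist p r ≤ ENNReal.ofReal |p.coord a - q.coord a| +
        ENNReal.ofReal |q.coord c - r.coord c| := by
    intro z z₁ z₂ hz hpz hrz h1 h2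
    rw [← h1, ← h2, hz, abs_sub_comm, abs_of_nonneg (by linarith [p.coord_le_one z]),
      abs_of_nonneg (by linarith [r.coord_le_one z])]
    refine (min_le_right _ _).trans ?_
    by_cases hrpos : 0 < r.coord z
    · refine (viaDist_le_of_onEdge hpz hrpos).trans ?_
      simp
    · have hr0 : r.coord z = 0 := le_antisymm (not_lt.1 hrpos) (r.nonneg z)
      have hr1 : r.coord z₂ = 1 := by have := hrz.2; linarith
      refine (viaDist_le_of_onEdge hpz (by rw [hr1]; exact one_pos : 0 < r.coord z₂)).trans ?_
      rw [SimpleGraph.edist_eq_one_iff_adj.2 hrz.1, hr0, hr1]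
      simp
  by_cases ha : 0 < q.coord a
  · by_cases hb : 0 < q.coord b
    · have hne := hq.1.ne
      rcases hq'.eq_or_eq ha with h | h <;> rcases hq'.eq_or_eq hb with h' | h'
      · exact absurd (h.trans h'.symm) hne
      · subst h h'
        exact (min_le_left _ _).trans ((segDist_le hp hr).trans (tri _ _ _))
      · subst h h'
        rw [flip hq' hr]
        exact (min_le_left _ _).trans ((segDist_le hp hr.symm).trans (tri _ _ _))
      · exact absurd (h.trans h'.symm) hne
    · have hb0 : q.coord b = 0 := le_antisymm (not_lt.1 hb) (q.nonneg b)
      have ha1 : q.coord a = 1 := by have := hq.2; linarith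
      rcases hq'.eq_or_eq ha with h | h
      · subst h; exact vertex a b d ha1 hp hr rfl rfl
      · subst h; exact vertex a b c ha1 hp hr.symm rfl (flip hq' hr).symm
  · have ha0 : q.coord a = 0 := le_antisymm (not_lt.1 ha) (q.nonneg a)
    have hb1 : q.coord b = 1 := by have := hq.2; linarith
    rcases hq'.eq_or_eq (by rw [hb1]; exact one_pos : 0 < q.coord b) with h | h
    · subst h; exact vertex b a d hb1 hp.symm hr (flip hp hq).symm rfl
    · subst h; exact vertex b a c hb1 hp.symm hr.symm (flip hp hq).symm (flip hq' hr).symm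

theorem arcDist_triangle (p q r : Point G) : arcDist p r ≤ arcDist p q + arcDist q r := by
  rcases min_choice (segDist p q) (viaDist p q) with h1 | h1 <;>
    rcases min_choice (segDist q r) (viaDist q r) with h2 | h2 <;>
    rw [arcDist.eq_1 p q, arcDist.eq_1 q r, h1, h2]
  · exact arcDist_le_seg_add_seg p q r
  · exact (min_le_right _ _).trans (viaDist_le_seg_add_via p q r)
  · refine (min_le_right _ _).trans ?_
    rw [viaDist_comm p r, viaDist_comm p q, segDist_comm q r, add_comm]
    exact viaDist_le_seg_add_via r q p
  · exact (min_le_right _ _).trans (viaDist_triangle p q r)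

/-- The graph as a metric length space (points of distinct components have distance `⊤`). -/
noncomputable instance : PseudoEMetricSpace (Point G) where
  edist := arcDist
  edist_self := arcDist_self
  edist_comm := arcDist_comm
  edist_triangle := arcDist_triangle

end Point

/-- The point set of the subgraph of `G` induced by the vertex set `U`: its vertices, and all the
points of those edges that have both endvertices in `U`. -/
def inducedPoints (G : SimpleGraph V) (U : Set V) : Set (Point G) :=
  {p | ∀ v, 0 < p.coord v → v ∈ U}

/-! ## The space `|G|` -/

/-- The set `|G| = G ∪ Ω(G)`. -/
inductive PointOrEnd (G : SimpleGraph V) : Type u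
  | point (p : Point G) : PointOrEnd G
  | ofEnd (ω : End G) : PointOrEnd G

namespace PointOrEnd

/-- The basic open neighbourhood `Ĉ_ε(X, ω)` of the end `ω`: the union of the component
`C(X, ω)`, the set `Ω(X, ω)` of the ends living in it, and the open ball of radius `ε` around
`C(X, ω)` in `G`. -/
def endNhd (ε : ℝ) (X : Finset V) (ω : End G) : Set (PointOrEnd G) :=
  point '' inducedPoints G (ω.comp X : Set V) ∪ ofEnd '' liveEnds X ω ∪
    point '' Metric.thickening ε (inducedPoints G (ω.comp X : Set V))

/-- The basic open sets of `MTop`: the open sets of the metric length space `G`, and the basic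
open neighbourhoods of the ends. -/
def basicOpens (G : SimpleGraph V) : Set (Set (PointOrEnd G)) :=
  {O | ∃ U : Set (Point G), IsOpen U ∧ O = point '' U} ∪
    {O | ∃ (ε : ℝ) (X : Finset V) (ω : End G), 0 < ε ∧ O = endNhd ε X ω}

/-- The topology `MTop` on `|G|`. -/
instance mTop (G : SimpleGraph V) : TopologicalSpace (PointOrEnd G) :=
  TopologicalSpace.generateFrom (basicOpens G)

theorem point_preimage_endNhd (ε : ℝ) (hε : 0 < ε) (X : Finset V) (ω : End G) (p : Point G) :
    point p ∈ endNhd ε X ω ↔ p ∈ Metric.thickening ε (inducedPoints G (ω.comp X : Set V)) := by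
  have := Metric.self_subset_thickening hε (inducedPoints G (ω.comp X : Set V))
  simp only [endNhd, mem_union, mem_image, point.injEq, exists_eq_right, reduceCtorEq, and_false,
    exists_false, or_false]
  exact ⟨fun h => h.elim (fun h => this h) id, Or.inr⟩

theorem ofEnd_mem_endNhd (ε : ℝ) (X : Finset V) (ω η : End G) :
    ofEnd η ∈ endNhd ε X ω ↔ η.comp X = ω.comp X := by
  simp [endNhd, liveEnds]

theorem comp_subset_comp {X Y : Finset V} (h : X ⊆ Y) (ω : End G) :
    (ω.comp Y : Set V) ⊆ (ω.comp X : Set V) := by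
  obtain ⟨R, rfl⟩ : ∃ R : Ray G, R.toEnd = ω := Quotient.exists_rep ω
  obtain ⟨M, hM⟩ := End.hasTailIn_comp X R
  obtain ⟨N, hN⟩ := End.hasTailIn_comp Y R
  have hsub : (X : Set V) ⊆ (Y : Set V) := Finset.coe_subset.2 h
  have := (R.toEnd.comp Y).subset_hom hsub (hN (max M N) (le_max_right _ _))
  rw [← Ray.eq_of_mem_of_mem this (hM (max M N) (le_max_left _ _))]
  exact (R.toEnd.comp Y).subset_hom hsub

theorem endNhd_subset {ε δ : ℝ} {X Y : Finset V} {ω η : End G} (hε : 0 < ε) (hεδ : ε ≤ δ)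
    (hXY : X ⊆ Y) (h : η.comp X = ω.comp X) : endNhd ε Y η ⊆ endNhd δ X ω := by
  have hsub : (η.comp Y : Set V) ⊆ (ω.comp X : Set V) := h ▸ comp_subset_comp hXY η
  rintro (p | ζ) hx
  · rw [point_preimage_endNhd _ hε] at hx
    rw [point_preimage_endNhd _ (hε.trans_le hεδ)]
    have hind : inducedPoints G (η.comp Y : Set V) ⊆ inducedPoints G (ω.comp X : Set V) :=
      fun p (hp : ∀ v, 0 < p.coord v → v ∈ (η.comp Y : Set V)) v hv => hsub (hp v hv)
    exact Metric.thickening_subset_of_subset _ hind (Metric.thickening_mono hεδ _ hx)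
  · rw [ofEnd_mem_endNhd] at hx ⊢
    obtain ⟨v, hv⟩ := (ζ.comp Y).nonempty
    have h1 := comp_subset_comp hXY ζ hv
    exact Ray.eq_of_mem_of_mem h1 (hsub (hx ▸ hv))

theorem isOpen_preimage_point {O : Set (PointOrEnd G)} (hO : O ∈ basicOpens G) :
    IsOpen (point ⁻¹' O) := by
  rcases hO with ⟨U, hU, rfl⟩ | ⟨ε, X, ω, hε, rfl⟩
  · rwa [preimage_image_eq _ fun _ _ h => point.inj h]
  · convert Metric.isOpen_thickening (δ := ε) (E := inducedPoints G (ω.comp X : Set V)) using 1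
    ext p
    exact point_preimage_endNhd ε hε X ω p

/-- The basic open sets do form a basis of `MTop`. -/
theorem isTopologicalBasis_basicOpens (G : SimpleGraph V) :
    TopologicalSpace.IsTopologicalBasis (basicOpens G) where
  exists_subset_inter := by
    classical
    rintro O₁ h₁ O₂ h₂ (p | ζ) hx
    · exact ⟨point '' (point ⁻¹' O₁ ∩ point ⁻¹' O₂),
        Or.inl ⟨_, (isOpen_preimage_point h₁).inter (isOpen_preimage_point h₂), rfl⟩,
        ⟨p, hx, rfl⟩, by rintro _ ⟨q, hq, rfl⟩; exact hq⟩
    · rcases h₁ with ⟨U, -, rfl⟩ | ⟨ε, X, ω, hε, rfl⟩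
      · simp at hx
      rcases h₂ with ⟨U, -, rfl⟩ | ⟨δ, Y, η, hδ, rfl⟩
      · simp at hx
      have h1 := (ofEnd_mem_endNhd _ _ _ _).1 hx.1
      have h2 := (ofEnd_mem_endNhd _ _ _ _).1 hx.2
      refine ⟨endNhd (min ε δ) (X ∪ Y) ζ, Or.inr ⟨_, _, _, lt_min hε hδ, rfl⟩,
        (ofEnd_mem_endNhd _ _ _ _).2 rfl, subset_inter ?_ ?_⟩
      · exact endNhd_subset (lt_min hε hδ) (min_le_left _ _) Finset.subset_union_left h1
      · exact endNhd_subset (lt_min hε hδ) (min_le_right _ _) Finset.subset_union_right h2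
  sUnion_eq := by
    refine eq_univ_of_forall ?_
    rintro (p | ω)
    · exact ⟨point '' univ, Or.inl ⟨univ, isOpen_univ, rfl⟩, ⟨p, trivial, rfl⟩⟩
    · exact ⟨endNhd 1 ∅ ω, Or.inr ⟨1, ∅, ω, one_pos, rfl⟩, (ofEnd_mem_endNhd _ _ _ _).2 rfl⟩
  eq_generateFrom := rfl

end PointOrEnd

/-- The neighbourhood `N(U)` of a set `U` of vertices: the vertices outside `U` with a neighbour
in `U`. -/
def neighbourhood (G : SimpleGraph V) (U : Set V) : Set V :=
  {v | v ∉ U ∧ ∃ w ∈ U, G.Adj w v}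

end GraphEnds

namespace GraphEnds

open SimpleGraph Filter

universe w

variable {V : Type w} {G : SimpleGraph V}

/-! ### Components of vertex-deleted subgraphs -/

/-! First countability at `ω` is purely combinatorial (`isCountablyGenerated_nhds_ofEnd_iff`): it
says that there are finite sets `X n` such that every `C(Y, ω)` contains some `C(X n, ω)`. The radii
contribute only the countable family `1 / (m + 1)`, and a neighbourhood of radius `1` already
determines the vertices of its component.

If `R` is a ray as in (ii), its initial segments are such sets (`Ray.hasCountableSeparators`). Given
`Y`, take a segment `X` containing `Y ∩ R` and the finite sets `N(C)` of all components `C` of `G -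
R` that meet `Y`. Were `C(X, ω)` to meet `Y`, it would be trapped in such a `C`, yet it contains a
tail of `R`. So it avoids `Y` and hence lies in `C(Y, ω)`.

Conversely, enumerate the vertices of all `X n` as `u 0, u 1, …` and build a ray greedily
(`exists_search_ray`): with `P` the set of vertices used so far, step inside `C(P, ω)` along a
shortest route to the first `u i` still in `C(P, ω)`. Each step brings this `u i` closer or cuts it
off from `ω`, so every `u i` is eventually cut off. Thus each `X n` is eventually avoided by `C(P k,
ω)`, and the `P k` are cofinal too. So `R` belongs to `ω`, and any vertex `x` outside `R` is outside
some `C(P k, ω)`; the component of `G - R` at `x` then has no neighbour in `C(P k, ω)`, which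
contains all later vertices of `R`. -/

/-- A component of `G - X` is contained in every set that it meets and that is closed under
adjacency outside `X`. -/
theorem componentCompl_subset_of_adj_closed {X S : Set V} (C : G.ComponentCompl X) {v : V}
    (hvC : v ∈ C) (hvS : v ∈ S) (hS : ∀ a b, a ∈ S → b ∉ X → G.Adj a b → b ∈ S) :
    (C : Set V) ⊆ S := by
  rintro w ⟨hwX, hw⟩
  obtain ⟨hvX, hv⟩ := hvC
  obtain ⟨p⟩ := ConnectedComponent.exact (hv.trans hw.symm)
  have key : ∀ {a b : (Xᶜ : Set V)}, (G.induce Xᶜ).Walk a b → (a : V) ∈ S → (b : V) ∈ S := by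
    intro a b p
    induction p with
    | nil => exact id
    | @cons _ c _ h _ ih => exact fun ha => ih (hS _ _ ha c.2 h)
  exact key p hvS

theorem mem_componentCompl_of_walk {X : Set V} (C : G.ComponentCompl X) {a b : V}
    (p : G.Walk a b) (hX : ∀ x ∈ p.support, x ∉ X) (hb : b ∈ C) : ∀ x ∈ p.support, x ∈ C := by
  induction p with
  | nil => simpa using hb
  | cons h q ih =>
    simp only [Walk.support_cons, List.mem_cons, forall_eq_or_imp] at hX ⊢
    have hq := ih hX.2 hb
    exact ⟨C.mem_of_adj _ _ (hq _ q.start_mem_support) hX.1 h.symm, hq⟩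

/-- If `X` is contained in `Y` and a component `D` of `G - Y` is not contained in the component
`C` of `G - X`, then the neighbourhood of `D` does not meet `C`. -/
theorem disjoint_neighbourhood_of_notMem {X Y : Set V} (hXY : X ⊆ Y) (C : G.ComponentCompl X)
    (D : G.ComponentCompl Y) {v : V} (hvD : v ∈ D) (hvC : v ∉ C) :
    Disjoint (neighbourhood G (D : Set V)) (C : Set V) := by
  have hD : (D : Set V) ⊆ {x | x ∉ C ∧ x ∈ D} := by
    refine componentCompl_subset_of_adj_closed D hvD ⟨hvC, hvD⟩ fun a b ha hb hab => ⟨fun hbC => ?_,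
      D.mem_of_adj _ _ ha.2 hb hab⟩
    exact ha.1 (C.mem_of_adj _ _ hbC (fun h => D.notMem_of_mem ha.2 (hXY h)) hab.symm)
  rw [Set.disjoint_left]
  rintro x ⟨-, y, hyD, hyx⟩ hxC
  exact (hD hyD).1 (C.mem_of_adj _ _ hxC (fun h => D.notMem_of_mem hyD (hXY h)) hyx.symm)

theorem neighbourhood_componentCompl_subset {X : Set V} (C : G.ComponentCompl X) :
    neighbourhood G (C : Set V) ⊆ X := by
  rintro x ⟨hx, y, hy, hyx⟩
  by_contra hX
  exact hx (C.mem_of_adj _ _ hy hX hyx)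

namespace End

variable (ω : End G)

theorem comp_meets_comp (X Y : Finset V) : ∃ v, v ∈ ω.comp X ∧ v ∈ ω.comp Y := by
  obtain ⟨R, rfl⟩ : ∃ R : Ray G, R.toEnd = ω := Quotient.exists_rep ω
  obtain ⟨M, hM⟩ := hasTailIn_comp X R
  obtain ⟨N, hN⟩ := hasTailIn_comp Y R
  exact ⟨_, hM _ (le_max_left M N), hN _ (le_max_right M N)⟩

/-- Since `C(X, ω)` is connected and avoids `Y`, it lies in one component of `G - Y`; tails of rays
in `ω` show which one. No inclusion between `X` and `Y` is needed. -/
theorem comp_subset_comp_of_disjoint {X Y : Finset V} (h : ∀ y ∈ Y, y ∉ ω.comp X) :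
    (ω.comp X : Set V) ⊆ ω.comp Y := by
  obtain ⟨v, hX, hY⟩ := ω.comp_meets_comp X Y
  have : (ω.comp X : Set V) ⊆ {x | x ∈ ω.comp X ∧ x ∈ ω.comp Y} := by
    refine componentCompl_subset_of_adj_closed _ hX ⟨hX, hY⟩ fun a b ha hb hab => ?_
    have hbX := (ω.comp X).mem_of_adj _ _ ha.1 hb hab
    exact ⟨hbX, (ω.comp Y).mem_of_adj _ _ ha.2 (fun hbY => h b hbY hbX) hab⟩
  exact fun x hx => (this hx).2

theorem comp_eq_of_comp_subset {X Y : Finset V} (h : (ω.comp X : Set V) ⊆ ω.comp Y) {η : End G}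
    (hη : η.comp X = ω.comp X) : η.comp Y = ω.comp Y := by
  obtain ⟨v, hX, hY⟩ := η.comp_meets_comp X Y
  exact Ray.eq_of_mem_of_mem hY (h (hη ▸ hX))

theorem toEnd_eq_of_forall_hasTailIn {R : Ray G}
    (h : ∀ Y : Finset V, R.HasTailIn (ω.comp Y)) : R.toEnd = ω := by
  obtain ⟨S, rfl⟩ : ∃ S : Ray G, S.toEnd = ω := Quotient.exists_rep ω
  exact Ray.toEnd_eq_iff.2 (Ray.equivalent_iff.2 fun Y => ⟨_, h Y, hasTailIn_comp Y S⟩)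

/-- Otherwise `C(X, ω)`, explored from a vertex of the smaller component, could never reach `w`.
This keeps the search below from getting stuck. -/
theorem exists_adj_mem_comp_insert [DecidableEq V] {X : Finset V} {w : V} (hw : w ∈ ω.comp X) :
    ∃ c ∈ ω.comp (insert w X), G.Adj w c := by
  by_contra! hno
  obtain ⟨v, hv, hv'⟩ := ω.comp_meets_comp X (insert w X)
  have hsub : (ω.comp X : Set V) ⊆ ω.comp (insert w X) := by
    refine componentCompl_subset_of_adj_closed _ hv hv' fun a b ha hb hab => ?_
    refine (ω.comp (insert w X)).mem_of_adj _ _ ha (fun hbX => ?_) hab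
    rcases Finset.mem_insert.1 (Finset.mem_coe.1 hbX) with rfl | h
    · exact hno a ha hab.symm
    · exact hb h
  exact (ω.comp (insert w X)).notMem_of_mem (hsub hw) (by simp)

/-- The end `ω` has a countable family of finite vertex sets whose components `C(X, ω)` are
cofinal among all the components at `ω`. -/
def HasCountableSeparators : Prop :=
  ∃ X : ℕ → Finset V, ∀ Y : Finset V, ∃ n, (ω.comp (X n) : Set V) ⊆ ω.comp Y

end End

/-! ### Neighbourhoods of ends -/

namespace Point

/-- A vertex, as a point of the graph. -/
noncomputable def ofVertex (G : SimpleGraph V) (v : V) : Point G where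
  coord := by classical exact Pi.single v 1
  nonneg w := by
    classical
    by_cases h : w = v
    · subst h; simp
    · simp [h]
  supported := Or.inl ⟨v, by simp, fun w hw => by simp [hw]⟩

@[simp]
theorem ofVertex_coord_self (v : V) : (ofVertex G v).coord v = 1 := by
  simp [ofVertex]

theorem ofVertex_coord_ne {v w : V} (h : w ≠ v) : (ofVertex G v).coord w = 0 := by
  simp [ofVertex, h]

theorem eq_of_ofVertex_coord_pos {v w : V} (h : 0 < (ofVertex G v).coord w) : w = v := by
  by_contra hne
  exact h.ne' (ofVertex_coord_ne hne)

/-- A point at distance less than `1` from a vertex lies in the open star of that vertex. -/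
theorem coord_pos_of_edist_lt_one {v : V} {p : Point G} (h : edist (ofVertex G v) p < 1) :
    0 < p.coord v := by
  by_contra hp
  have hp0 : p.coord v = 0 := le_antisymm (not_lt.1 hp) (p.nonneg v)
  -- On a common edge, `p` would be the endvertex opposite `v`; a connection through vertices starts
  -- at `v` and ends at a vertex other than `v`. Both have length at least `1`.
  refine h.not_ge (le_min ?_ ?_)
  · refine le_iInf fun a => le_iInf fun b => le_iInf fun hab => ?_
    have hv : v = a ∨ v = b := hab.1.eq_or_eq (by simp)
    have ha := hab.1.2
    have hb := hab.2.2
    rcases hv with rfl | rfl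
    · simp [hp0]
    · rw [ofVertex_coord_self] at ha
      have h1 : (ofVertex G v).coord a = 0 := by linarith
      have h2 : p.coord a = 1 := by linarith
      simp [h1, h2]
  · refine le_iInf fun a => le_iInf fun b => le_iInf fun hab => ?_
    obtain rfl := eq_of_ofVertex_coord_pos hab.1
    have hne : a ≠ b := by
      rintro rfl
      exact hab.2.ne' hp0
    have h1 : (1 : ℕ∞) ≤ G.edist a b :=
      Order.one_le_iff_pos.2 (pos_iff_ne_zero.2 fun h0 => hne (SimpleGraph.edist_eq_zero_iff.1 h0))
    have h2 : (1 : ℝ≥0∞) ≤ (G.edist a b : ℝ≥0∞) := by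
      simpa using ENat.toENNReal_le.2 h1
    exact h2.trans (le_add_right le_add_self)

end Point

namespace PointOrEnd

theorem ofVertex_mem_endNhd {ε : ℝ} (hε : 0 < ε) {X : Finset V} {ω : End G} {v : V}
    (hv : v ∈ ω.comp X) : point (Point.ofVertex G v) ∈ endNhd ε X ω := by
  rw [point_preimage_endNhd ε hε]
  refine Metric.self_subset_thickening hε _ fun x hx => ?_
  rwa [Point.eq_of_ofVertex_coord_pos hx]

theorem mem_comp_of_ofVertex_mem_endNhd_one {X : Finset V} {ω : End G} {v : V}
    (hv : point (Point.ofVertex G v) ∈ endNhd 1 X ω) : v ∈ ω.comp X := by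
  rw [point_preimage_endNhd 1 one_pos, Metric.mem_thickening_iff_exists_edist_lt] at hv
  obtain ⟨p, hp, hlt⟩ := hv
  exact hp v (Point.coord_pos_of_edist_lt_one (by simpa using hlt))

theorem endNhd_subset_of_comp_subset {ε δ : ℝ} {X Y : Finset V} {ω : End G} (hε : 0 < ε)
    (hεδ : ε ≤ δ) (h : (ω.comp X : Set V) ⊆ ω.comp Y) : endNhd ε X ω ⊆ endNhd δ Y ω := by
  rintro (p | η) hx
  · rw [point_preimage_endNhd _ hε] at hx
    rw [point_preimage_endNhd _ (hε.trans_le hεδ)]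
    have hind : inducedPoints G (ω.comp X : Set V) ⊆ inducedPoints G (ω.comp Y : Set V) :=
      fun q (hq : ∀ v, 0 < q.coord v → v ∈ (ω.comp X : Set V)) v hv => h (hq v hv)
    exact Metric.thickening_mono hεδ _ (Metric.thickening_subset_of_subset _ hind hx)
  · rw [ofEnd_mem_endNhd] at hx ⊢
    exact ω.comp_eq_of_comp_subset h hx

/-- Open sets of `G` contain no ends, and a basic neighbourhood of another end that contains `ω` can
be recentred at `ω`. -/
theorem nhds_ofEnd_hasBasis (ω : End G) :
    (𝓝 (ofEnd ω)).HasBasis (fun p : ℝ × Finset V => 0 < p.1) fun p => endNhd p.1 p.2 ω := by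
  refine ⟨fun s => ?_⟩
  rw [(isTopologicalBasis_basicOpens G).mem_nhds_iff]
  constructor
  · rintro ⟨O, ⟨U, -, rfl⟩ | ⟨ε, X, η, hε, rfl⟩, hω, hO⟩
    · simp at hω
    · rw [ofEnd_mem_endNhd] at hω
      exact ⟨(ε, X), hε, (endNhd_subset hε le_rfl subset_rfl hω).trans hO⟩
  · rintro ⟨⟨ε, X⟩, hε, hs⟩
    exact ⟨_, Or.inr ⟨ε, X, ω, hε, rfl⟩, (ofEnd_mem_endNhd _ _ _ _).2 rfl, hs⟩

theorem isCountablyGenerated_nhds_ofEnd_iff (ω : End G) :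
    (𝓝 (ofEnd ω)).IsCountablyGenerated ↔ ω.HasCountableSeparators := by
  have hb := nhds_ofEnd_hasBasis ω
  constructor
  · intro h
    obtain ⟨s, hs⟩ := (𝓝 (ofEnd ω)).exists_antitone_basis
    choose p hp hps using fun n => hb.mem_iff.1 (hs.1.mem_of_mem (i := n) trivial)
    refine ⟨fun n => (p n).2, fun Y => ?_⟩
    -- With radius `1`, no vertex outside `C(Y, ω)` belongs to the neighbourhood.
    obtain ⟨n, -, hn⟩ := hs.1.mem_iff.1 (hb.mem_of_mem (i := (1, Y)) one_pos)
    exact ⟨n, fun v hv => mem_comp_of_ofVertex_mem_endNhd_one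
      (hn (hps n (ofVertex_mem_endNhd (hp n) hv)))⟩
  · rintro ⟨X, hX⟩
    have : (𝓝 (ofEnd ω)).HasBasis (fun _ : ℕ × ℕ => True)
        fun p => endNhd (1 / ((p.1 : ℝ) + 1)) (X p.2) ω := by
      refine hb.to_hasBasis (fun ⟨ε, Y⟩ hε => ?_) fun p _ => ⟨(_, X p.2), ?_, subset_rfl⟩
      · obtain ⟨n, hn⟩ := hX Y
        obtain ⟨m, hm⟩ := exists_nat_one_div_lt (show 0 < ε from hε)
        exact ⟨(m, n), trivial,
          endNhd_subset_of_comp_subset Nat.one_div_pos_of_nat hm.le hn⟩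
      · exact Nat.one_div_pos_of_nat
    exact HasCountableBasis.isCountablyGenerated ⟨this, Set.to_countable _⟩

end PointOrEnd

/-! ### Separators from a ray -/

theorem Ray.hasCountableSeparators (R : Ray G)
    (hR : ∀ C : G.ComponentCompl R.verts, (neighbourhood G (C : Set V)).Finite) :
    R.toEnd.HasCountableSeparators := by
  classical
  have hinit : ∀ F : Set V, F.Finite → F ⊆ R.verts →
      ∃ n, F ⊆ ((Finset.range n).image R.vert : Finset V) := by
    intro F hF hFR
    obtain ⟨N, hN⟩ := (hF.preimage R.injective.injOn).bddAbove
    refine ⟨N + 1, fun v hv => ?_⟩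
    obtain ⟨m, rfl⟩ := hFR hv
    have := hN (show m ∈ R.vert ⁻¹' F from hv)
    simp only [Finset.coe_image, Finset.coe_range]
    exact ⟨m, Set.mem_Iio.2 (by omega), rfl⟩
  refine ⟨fun n => (Finset.range n).image R.vert, fun Y => ?_⟩
  -- `N y` is empty for `y` on the ray, so a single union over `Y` covers both cases.
  let N : V → Set V := fun y => {x | ∃ C : G.ComponentCompl R.verts, y ∈ C ∧
    x ∈ neighbourhood G (C : Set V)}
  have hNfin : ∀ y, (N y).Finite := by
    intro y
    by_cases hy : y ∈ R.verts
    · convert Set.finite_empty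
      exact Set.eq_empty_of_forall_notMem fun x ⟨C, hC, _⟩ => C.notMem_of_mem hC hy
    · refine (hR (G.componentComplMk hy)).subset ?_
      rintro x ⟨C, hC, hx⟩
      rwa [Ray.eq_of_mem_of_mem (G.componentComplMk_mem hy) hC]
  obtain ⟨n, hn⟩ := hinit ((Y ∩ R.verts) ∪ ⋃ y ∈ Y, N y)
    ((Y.finite_toSet.inter_of_left _).union (Y.finite_toSet.biUnion fun y _ => hNfin y)) (by
      refine Set.union_subset Set.inter_subset_right (Set.iUnion₂_subset fun y _ => ?_)
      rintro x ⟨C, -, hx⟩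
      exact neighbourhood_componentCompl_subset C hx)
  refine ⟨n, R.toEnd.comp_subset_comp_of_disjoint fun y hy hyC => ?_⟩
  have hyR : y ∉ R.verts := fun h => (R.toEnd.comp _).notMem_of_mem hyC (hn (Or.inl ⟨hy, h⟩))
  let C := G.componentComplMk hyR
  have hyC' : y ∈ C := G.componentComplMk_mem hyR
  -- Leaving `C` means passing through `N(C)`, which lies in the deleted initial segment.
  have hsub : (R.toEnd.comp ((Finset.range n).image R.vert) : Set V) ⊆ C := by
    refine componentCompl_subset_of_adj_closed _ hyC hyC' fun a b ha hb hab => ?_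
    by_contra hbC
    exact hb (hn (Or.inr (Set.mem_biUnion hy ⟨C, hyC', hbC, a, ha, hab⟩)))
  obtain ⟨M, hM⟩ := End.hasTailIn_comp ((Finset.range n).image R.vert) R
  exact C.notMem_of_mem (hsub (hM M le_rfl)) ⟨M, rfl⟩

/-! ### A ray from separators -/

namespace End

variable (ω : End G)

/-- There is a walk of length `d` from `v` to `u` that runs in `C(X, ω)` after `v`. -/
def ReachesIn (X : Finset V) (v u : V) (d : ℕ) : Prop :=
  ∃ p : G.Walk v u, p.length = d ∧ ∀ x ∈ p.support, x = v ∨ x ∈ ω.comp X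

theorem exists_reachesIn {X : Finset V} {v u : V} (hv : ∃ c ∈ ω.comp X, G.Adj v c)
    (hu : u ∈ ω.comp X) : ∃ d, ω.ReachesIn X v u d := by
  obtain ⟨c, hc, hvc⟩ := hv
  have hsub : (ω.comp X : Set V) ⊆ {x | x ∈ ω.comp X ∧ ∃ d, ω.ReachesIn X v x d} := by
    refine componentCompl_subset_of_adj_closed _ hc ⟨hc, 1, hvc.toWalk, rfl, ?_⟩ ?_
    · intro x hx
      obtain rfl | rfl : x = v ∨ x = c := by simpa using hx
      · exact Or.inl rfl
      · exact Or.inr hc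
    · rintro a b ⟨ha, d, p, -, hp⟩ hb hab
      have hbX := (ω.comp X).mem_of_adj _ _ ha hb hab
      refine ⟨hbX, _, p.concat hab, rfl, fun x hx => ?_⟩
      rw [Walk.support_concat, List.mem_append, List.mem_singleton] at hx
      rcases hx with hx | rfl
      · exact hp x hx
      · exact Or.inr hbX
  exact (hsub hu).2

/-- One step towards `u` inside `C(X, ω)`: afterwards `u` is closer, or separated from `ω`. -/
theorem exists_step_towards [DecidableEq V] {X : Finset V} {v u : V} {d : ℕ} (hvX : v ∈ X)
    (hu : u ∈ ω.comp X) (hd : ω.ReachesIn X v u d) :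
    ∃ w ∈ ω.comp X, G.Adj v w ∧
      (u ∈ ω.comp (insert w X) → ∃ d' < d, ω.ReachesIn (insert w X) w u d') := by
  obtain ⟨p, rfl, hp⟩ := hd
  -- Shortcut to a path, so that after `v` it stays in `C(X, ω)` and after `w` it does not return to
  -- `w`.
  have hb : ∀ x ∈ p.bypass.support, x = v ∨ x ∈ ω.comp X := fun x hx =>
    hp x (p.support_bypass_subset_support hx)
  have hlen := p.length_bypass_le_length
  have hpath := p.bypass_isPath
  generalize p.bypass = q at hb hlen hpath
  cases q with
  | nil => exact absurd hvX ((ω.comp X).notMem_of_mem hu)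
  | @cons _ w _ h q =>
    rw [Walk.cons_isPath_iff] at hpath
    have hq : ∀ x ∈ q.support, x ∈ ω.comp X := fun x hx =>
      (hb x (by simp [hx])).resolve_left (by rintro rfl; exact hpath.2 hx)
    refine ⟨w, hq w q.start_mem_support, h, fun hu' => ⟨q.length, ?_, q, rfl, ?_⟩⟩
    · rw [Walk.length_cons] at hlen
      omega
    · cases q with
      | nil => simp
      | cons h' r =>
        -- The rest of the path avoids `X` and `w` and ends at `u`, so it lies wholly in the
        -- component of `u`.
        have hr := mem_componentCompl_of_walk (ω.comp (insert w X)) r (fun x hx hxX => by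
          rcases Finset.mem_insert.1 (Finset.mem_coe.1 hxX) with rfl | hX
          · exact ((Walk.cons_isPath_iff _ _).1 hpath.1).2 hx
          · exact (ω.comp X).notMem_of_mem (hq x (by simp [hx])) hX) hu'
        intro x hx
        rw [Walk.support_cons, List.mem_cons] at hx
        exact hx.imp_right (hr x)

/-- One step of the search: it goes towards the first `u i` that is not yet separated from `ω`. -/
theorem exists_search_step [DecidableEq V] (u : ℕ → V) {X : Finset V} {v : V} (hvX : v ∈ X)
    (hv : ∃ c ∈ ω.comp X, G.Adj v c) :
    ∃ w ∈ ω.comp X, G.Adj v w ∧ ∀ i, u i ∈ ω.comp (insert w X) → (∀ j < i, u j ∉ ω.comp X) →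
      sInf {d | ω.ReachesIn (insert w X) w (u i) d} < sInf {d | ω.ReachesIn X v (u i) d} := by
  classical
  have hmono : ∀ w, (ω.comp (insert w X) : Set V) ⊆ ω.comp X := fun w =>
    PointOrEnd.comp_subset_comp (Finset.subset_insert w X) ω
  by_cases h : ∃ i, u i ∈ ω.comp X
  · have hi := Nat.find_spec h
    -- As `sInf ∅ = 0` in `ℕ`, the infimum is a genuine distance only because `exists_reachesIn`
    -- makes the set nonempty.
    obtain ⟨w, hw, hvw, hcl⟩ := ω.exists_step_towards hvX hi
      (Nat.sInf_mem (ω.exists_reachesIn hv hi))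
    refine ⟨w, hw, hvw, fun i hiw hlt => ?_⟩
    have hfind : Nat.find h = i := (Nat.find_eq_iff h).2 ⟨hmono w hiw, hlt⟩
    rw [hfind] at hcl
    obtain ⟨d', hd', hr⟩ := hcl hiw
    exact (Nat.sInf_le hr).trans_lt hd'
  · obtain ⟨c, hc, hvc⟩ := hv
    exact ⟨c, hc, hvc, fun i hi => absurd ⟨i, hmono c hi⟩ h⟩

/-- For every sequence `u` of vertices there is a ray, with initial segments `P k`, that runs
in `C(P k, ω)` after `P k`, and each `u i` is eventually separated from `ω` by the `P k`. -/
theorem exists_search_ray [DecidableEq V] (u : ℕ → V) :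
    ∃ (R : Ray G) (P : ℕ → Finset V), (∀ k, (P k : Set V) ⊆ R.verts) ∧
      (∀ k n, k < n → R.vert n ∈ ω.comp (P k)) ∧
      ∀ i, ∃ K, ∀ k, K ≤ k → u i ∉ ω.comp (P k) := by
  -- A state is the set of vertices used so far and the current vertex, from which the search can
  -- still move on towards `ω`.
  let State := {s : Finset V × V // s.2 ∈ s.1 ∧ ∃ c ∈ ω.comp s.1, G.Adj s.2 c}
  choose next hmem hadj hdec using fun s : State => ω.exists_search_step u s.2.1 s.2.2
  let step : State → State := fun s =>
    ⟨(insert (next s) s.1.1, next s), Finset.mem_insert_self _ _,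
      ω.exists_adj_mem_comp_insert (hmem s)⟩
  obtain ⟨v₀, hv₀⟩ := (ω.comp ∅).nonempty
  let s₀ : State := ⟨(insert v₀ ∅, v₀), Finset.mem_insert_self _ _,
    ω.exists_adj_mem_comp_insert hv₀⟩
  let s : ℕ → State := fun n => step^[n] s₀
  have hs : ∀ n, s (n + 1) = step (s n) := fun n => Function.iterate_succ_apply' step n s₀
  let P : ℕ → Finset V := fun n => (s n).1.1
  let v : ℕ → V := fun n => (s n).1.2
  have hv : ∀ n, v (n + 1) = next (s n) := fun n => by simp only [v, hs, step]
  have hP : ∀ n, P (n + 1) = insert (next (s n)) (P n) := fun n => by simp only [P, hs, step]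
  have hPmono : Monotone P := monotone_nat_of_le_succ fun n => by
    rw [hP]; exact Finset.subset_insert _ _
  have hcomp : ∀ {k n}, k ≤ n → (ω.comp (P n) : Set V) ⊆ ω.comp (P k) := fun h =>
    PointOrEnd.comp_subset_comp (hPmono h) ω
  have htail : ∀ k n, k < n → v n ∈ ω.comp (P k) := by
    intro k n hkn
    obtain ⟨n, rfl⟩ := Nat.exists_eq_add_of_lt hkn
    rw [hv]
    exact hcomp (by omega) (hmem (s (k + n)))
  have hne : ∀ k n, k < n → v k ≠ v n := fun k n hkn h =>
    (ω.comp (P k)).notMem_of_mem (htail k n hkn) (h ▸ (s k).2.1)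
  refine ⟨⟨v, fun k n h => ?_, fun n => ?_⟩, P, fun k => ?_, htail, fun i => ?_⟩
  · rcases lt_trichotomy k n with hlt | heq | hlt
    · exact absurd h (hne _ _ hlt)
    · exact heq
    · exact absurd h.symm (hne _ _ hlt)
  · rw [hv]
    exact hadj (s n)
  · induction k with
    | zero =>
      intro x hx
      have : x = v₀ := by simpa [P, s, s₀] using hx
      exact ⟨0, this.symm⟩
    | succ k ih =>
      intro x hx
      rw [hP, Finset.coe_insert] at hx
      rcases hx with rfl | hx
      · exact ⟨k + 1, hv k⟩
      · exact ih hx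
  · induction i using Nat.strong_induction_on with
    | _ i ih =>
      choose! K hK using ih
      by_contra! hcon
      have hall : ∀ k, u i ∈ ω.comp (P k) := fun k => by
        obtain ⟨n, hn, hu⟩ := hcon k
        exact hcomp hn hu
      let f : ℕ → ℕ := fun k => sInf {d | ω.ReachesIn (P k) (v k) (u i) d}
      -- From this stage on all `u j` with `j < i` are cut off, so every step is directed at `u i`;
      -- its distance cannot decrease forever.
      have hf : ∀ k, (Finset.range i).sup K ≤ k → f (k + 1) < f k := fun k hk => by
        have h := hdec (s k) i (by rw [← hP]; exact hall (k + 1)) fun j hj =>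
          hK j hj k ((Finset.le_sup (Finset.mem_range.2 hj)).trans hk)
        simpa only [f, hP, hv] using h
      have hanti : StrictAnti fun m => f ((Finset.range i).sup K + m) :=
        strictAnti_nat_of_succ_lt fun m => hf _ (Nat.le_add_right _ _)
      exact not_strictAnti_of_wellFoundedLT _ hanti

theorem HasCountableSeparators.exists_ray {ω : End G} (h : ω.HasCountableSeparators) :
    ∃ R : Ray G, R.toEnd = ω ∧
      ∀ C : G.ComponentCompl R.verts, (neighbourhood G (C : Set V)).Finite := by
  classical
  obtain ⟨X, hX⟩ := h
  have : Nonempty V := (ω.comp ∅).nonempty.to_type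
  obtain ⟨u, hu⟩ := Set.countable_iff_exists_subset_range.1
    (Set.countable_iUnion fun n => (X n).countable_toSet)
  obtain ⟨R, P, hPR, htail, hsep⟩ := ω.exists_search_ray u
  have hcof : ∀ Y : Finset V, ∃ k, (ω.comp (P k) : Set V) ⊆ ω.comp Y := by
    intro Y
    obtain ⟨n, hn⟩ := hX Y
    have hev : ∀ x ∈ X n, ∀ᶠ k in atTop, x ∉ ω.comp (P k) := fun x hx => by
      obtain ⟨i, rfl⟩ := hu (Set.mem_iUnion.2 ⟨n, hx⟩)
      exact eventually_atTop.2 (hsep i)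
    obtain ⟨k, hk⟩ := ((Filter.eventually_all_finset (X n)).2 hev).exists
    exact ⟨k, (ω.comp_subset_comp_of_disjoint hk).trans hn⟩
  refine ⟨R, ω.toEnd_eq_of_forall_hasTailIn fun Y => ?_, fun C => ?_⟩
  · obtain ⟨k, hk⟩ := hcof Y
    exact ⟨k + 1, fun n hn => hk (htail k n hn)⟩
  · obtain ⟨x, hx⟩ := C.nonempty
    -- Cofinality for the singleton puts `x`, and hence all of `C`, outside `C(P k, ω)`.
    obtain ⟨k, hk⟩ := hcof {x}
    have hdisj := disjoint_neighbourhood_of_notMem (hPR k) (ω.comp (P k)) C hx fun h =>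
      (ω.comp {x}).notMem_of_mem (hk h) (by simp)
    refine ((Set.finite_Iic k).image R.vert).subset fun y hy => ?_
    obtain ⟨n, rfl⟩ := neighbourhood_componentCompl_subset C hy
    -- Ray vertices with index above `k` lie in `C(P k, ω)`, which contains no neighbour of `C`.
    refine ⟨n, Set.mem_Iic.2 (not_lt.1 fun hkn => ?_), rfl⟩
    exact Set.disjoint_left.1 hdisj hy (htail k n hkn)

end End

end GraphEnds

theorem mainTheorem10 {V : Type*} (G : SimpleGraph V) (ω : GraphEnds.End G) :
    (𝓝 (GraphEnds.PointOrEnd.ofEnd ω)).IsCountablyGenerated ↔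
      ∃ R : GraphEnds.Ray G, R.toEnd = ω ∧
        ∀ C : G.ComponentCompl R.verts,
          (GraphEnds.neighbourhood G (C : Set V)).Finite := by
  rw [GraphEnds.PointOrEnd.isCountablyGenerated_nhds_ofEnd_iff]
  refine ⟨fun h => h.exists_ray, ?_⟩
  rintro ⟨R, rfl, hR⟩
  exact R.hasCountableSeparators hR
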